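/- Let $\rho\ge 1$ be an integer and $p>0$ a real number. Let $E_{\rho,p}$ be the complex vector space of entire functions $f$ with $$\lim_{R\to\infty}\ \sup_{|z|\ge R}\frac{\ln|f(z)|}{|z|^\rho}\le p$$ (where $\ln 0=-\infty$), endowed with the Fréchet topology generated by the norms $$\|f\|_n=\sup_{z\in\mathbb C}\exp\bigl[-(p+1/n)|z|^\rho\bigr]\,|f(z)|,\qquad n=1,2,3,\dots$$ Call an entire function $f$ typical if it is surjective (as a map $\mathbb C\to\mathbb C$), has infinitely many critical points (points $z$ with $f'(z)=0$), each of them is non-degenerate (that is, $f''(z)\ne 0$), and the values of $f$ at distinct critical points are different. Let $\mathfrak T$ be the set of typical functions in $E_{\rho,p}$. Then there is a subset of $\mathfrak T$ which is a $G_\delta$ set in $E_{\rho,p}$ and dense in $E_{\rho,p}$. -/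

import Mathlib

open Filter Bornology

/-- The growth condition
`lim_{R → ∞} sup_{|z| ≥ R} ln |f z| / |z| ^ ρ ≤ p`.
It is read in the extended reals, with `ln 0 = -∞`. -/
def HasOrderType (ρ : ℕ+) (p : ℝ) (f : ℂ → ℂ) : Prop :=
  limsup (fun z : ℂ => ENNReal.log ‖f z‖ₑ / ((‖z‖ ^ (ρ : ℕ) : ℝ) : EReal)) (cobounded ℂ)
    ≤ (p : EReal)

theorem log_enorm_div_le_iff (w : ℂ) (c r : ℝ) (hr : 0 < r) :
    ENNReal.log ‖w‖ₑ / (r : EReal) ≤ (c : EReal) ↔ ‖w‖ ≤ Real.exp (c * r) := by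
  rw [EReal.div_le_iff_le_mul (by exact_mod_cast hr) (EReal.coe_ne_top r), ← EReal.coe_mul,
    ← EReal.log_exp ((r * c : ℝ) : EReal), ENNReal.log_le_log_iff, EReal.exp_coe,
    ← ofReal_norm, ENNReal.ofReal_le_ofReal_iff (Real.exp_pos _).le, mul_comm]

theorem tendsto_norm_pow_cobounded (ρ : ℕ+) :
    Tendsto (fun z : ℂ => ‖z‖ ^ (ρ : ℕ)) (cobounded ℂ) atTop :=
  (tendsto_pow_atTop ρ.ne_zero).comp tendsto_norm_cobounded_atTop

theorem hasOrderType_iff (ρ : ℕ+) (p : ℝ) (f : ℂ → ℂ) :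
    HasOrderType ρ p f ↔
      ∀ ε > 0, ∀ᶠ z in cobounded ℂ, ‖f z‖ ≤ Real.exp ((p + ε) * ‖z‖ ^ (ρ : ℕ)) := by
  have hpos : ∀ᶠ z in cobounded ℂ, 0 < ‖z‖ ^ (ρ : ℕ) :=
    (tendsto_norm_pow_cobounded ρ).eventually_gt_atTop 0
  unfold HasOrderType
  rw [limsup_le_iff']
  constructor
  · intro h ε hε
    have hlt : (p : EReal) < ((p + ε : ℝ) : EReal) := by
      exact_mod_cast lt_add_of_pos_right p hε
    filter_upwards [h _ hlt, hpos] with z hz hz0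
    exact (log_enorm_div_le_iff _ _ _ hz0).1 hz
  · intro h y hy
    obtain ⟨c, hpc, hcy⟩ := EReal.lt_iff_exists_real_btwn.1 hy
    have hpc' : p < c := by exact_mod_cast hpc
    filter_upwards [h (c - p) (sub_pos.2 hpc'), hpos] with z hz hz0
    rw [add_sub_cancel] at hz
    exact ((log_enorm_div_le_iff _ _ _ hz0).2 hz).trans hcy.le

/-- `C * exp ((p + ε/2) |z|^ρ)` is eventually dominated by `exp ((p + ε) |z|^ρ)`. -/
theorem eventually_mul_exp_le (ρ : ℕ+) (p C : ℝ) {ε : ℝ} (hε : 0 < ε) :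
    ∀ᶠ z : ℂ in cobounded ℂ, C * Real.exp ((p + ε / 2) * ‖z‖ ^ (ρ : ℕ)) ≤
      Real.exp ((p + ε) * ‖z‖ ^ (ρ : ℕ)) := by
  filter_upwards [(tendsto_norm_pow_cobounded ρ).eventually_ge_atTop (C / (ε / 2))] with z hz
  have h1 : C ≤ Real.exp (ε / 2 * ‖z‖ ^ (ρ : ℕ)) := by
    rw [div_le_iff₀ (half_pos hε)] at hz
    linarith [Real.add_one_le_exp (ε / 2 * ‖z‖ ^ (ρ : ℕ))]
  calc C * Real.exp ((p + ε / 2) * ‖z‖ ^ (ρ : ℕ))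
      ≤ Real.exp (ε / 2 * ‖z‖ ^ (ρ : ℕ)) * Real.exp ((p + ε / 2) * ‖z‖ ^ (ρ : ℕ)) := by gcongr
    _ = Real.exp ((p + ε) * ‖z‖ ^ (ρ : ℕ)) := by rw [← Real.exp_add]; ring_nf

/-- The complex vector space of entire functions of order `ρ` and type at most `p`. -/
def entireSubmodule (ρ : ℕ+) (p : ℝ) : Submodule ℂ (ℂ → ℂ) where
  carrier := {f | Differentiable ℂ f ∧ HasOrderType ρ p f}
  zero_mem' := by
    refine ⟨differentiable_const _, (hasOrderType_iff _ _ _).2 fun ε _ => ?_⟩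
    filter_upwards with z
    simpa using (Real.exp_pos _).le
  add_mem' := by
    rintro f g ⟨hf, hf'⟩ ⟨hg, hg'⟩
    refine ⟨hf.add hg, (hasOrderType_iff _ _ _).2 fun ε hε => ?_⟩
    filter_upwards [(hasOrderType_iff _ _ _).1 hf' _ (half_pos hε),
      (hasOrderType_iff _ _ _).1 hg' _ (half_pos hε), eventually_mul_exp_le ρ p 2 hε]
      with z h1 h2 h3
    have := norm_add_le (f z) (g z)
    simp only [Pi.add_apply]
    linarith
  smul_mem' := by
    rintro c f ⟨hf, hf'⟩
    refine ⟨hf.const_smul c, (hasOrderType_iff _ _ _).2 fun ε hε => ?_⟩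
    filter_upwards [(hasOrderType_iff _ _ _).1 hf' _ (half_pos hε),
      eventually_mul_exp_le ρ p ‖c‖ hε] with z h1 h2
    simp only [Pi.smul_apply, norm_smul]
    exact (mul_le_mul_of_nonneg_left h1 (norm_nonneg c)).trans h2

/-- The space `E_{ρ,p}`, as a type of its own so that it carries only the topology
given below, not the topology of pointwise convergence. -/
def EntireSpace (ρ : ℕ+) (p : ℝ) : Type := entireSubmodule ρ p

namespace EntireSpace

variable {ρ : ℕ+} {p : ℝ}

noncomputable instance : AddCommGroup (EntireSpace ρ p) :=
  inferInstanceAs (AddCommGroup (entireSubmodule ρ p))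

noncomputable instance : Module ℂ (EntireSpace ρ p) :=
  inferInstanceAs (Module ℂ (entireSubmodule ρ p))

instance : CoeFun (EntireSpace ρ p) (fun _ => ℂ → ℂ) := ⟨fun f => f.1⟩

/-- The weight `v_n(|z|) = exp (-(p + 1/n) |z| ^ ρ)`. -/
noncomputable def weight (ρ : ℕ+) (p : ℝ) (n : ℕ+) (z : ℂ) : ℝ :=
  Real.exp (-(p + 1 / (n : ℝ)) * ‖z‖ ^ (ρ : ℕ))

theorem weight_pos (n : ℕ+) (z : ℂ) : 0 < weight ρ p n z := Real.exp_pos _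

/-- Every element of `E_{ρ,p}` has a finite weighted norm, so that the supremum below is a
genuine one. -/
theorem bddAbove_weight_mul_norm (n : ℕ+) (f : EntireSpace ρ p) :
    BddAbove (Set.range fun z : ℂ => weight ρ p n z * ‖f z‖) := by
  have hn : (0 : ℝ) < 1 / (n : ℝ) := by have := n.pos; positivity
  have h := (hasOrderType_iff _ _ _).1 f.2.2 _ hn
  rw [Metric.cobounded_eq_cocompact, eventually_iff, mem_cocompact] at h
  obtain ⟨K, hK, hKs⟩ := h
  have hc : Continuous fun z : ℂ => weight ρ p n z * ‖f z‖ := by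
    have := f.2.1.continuous
    unfold weight
    fun_prop
  obtain ⟨B, hB⟩ := hK.bddAbove_image hc.continuousOn
  refine ⟨max B 1, ?_⟩
  rintro _ ⟨z, rfl⟩
  by_cases hz : z ∈ K
  · exact (hB ⟨z, hz, rfl⟩).trans (le_max_left _ _)
  · refine le_trans ?_ (le_max_right _ _)
    have h1 : ‖f z‖ ≤ Real.exp ((p + 1 / (n : ℝ)) * ‖z‖ ^ (ρ : ℕ)) := hKs hz
    calc weight ρ p n z * ‖f z‖
        ≤ weight ρ p n z * Real.exp ((p + 1 / (n : ℝ)) * ‖z‖ ^ (ρ : ℕ)) :=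
          mul_le_mul_of_nonneg_left h1 (weight_pos n z).le
      _ = 1 := by rw [weight, ← Real.exp_add, neg_mul, neg_add_cancel, Real.exp_zero]

/-- The weighted norms `‖f‖_n = sup_z v_n(|z|) |f z|`. -/
noncomputable def wnorm (ρ : ℕ+) (p : ℝ) : SeminormFamily ℂ (EntireSpace ρ p) ℕ+ := fun n =>
  Seminorm.of (fun f => ⨆ z : ℂ, weight ρ p n z * ‖f z‖)
    (fun f g => by
      refine ciSup_le fun z => ?_
      calc weight ρ p n z * ‖f z + g z‖
          ≤ weight ρ p n z * ‖f z‖ + weight ρ p n z * ‖g z‖ := by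
            rw [← mul_add]
            exact mul_le_mul_of_nonneg_left (norm_add_le _ _) (weight_pos n z).le
        _ ≤ _ := add_le_add (le_ciSup (bddAbove_weight_mul_norm n f) z)
            (le_ciSup (bddAbove_weight_mul_norm n g) z))
    (fun c f => by
      rw [Real.mul_iSup_of_nonneg (norm_nonneg c)]
      refine iSup_congr fun z => ?_
      change weight ρ p n z * ‖c • f z‖ = _
      rw [norm_smul]
      ring)

theorem wnorm_apply (n : ℕ+) (f : EntireSpace ρ p) :
    wnorm ρ p n f = ⨆ z : ℂ, weight ρ p n z * ‖f z‖ := rfl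

/-- The Fréchet topology of `E_{ρ,p}`: the vector space topology generated by the
norms `‖·‖_n`, `n = 1, 2, …`. -/
noncomputable instance : TopologicalSpace (EntireSpace ρ p) :=
  (wnorm ρ p).moduleFilterBasis.topology

theorem withSeminorms : WithSeminorms (wnorm ρ p) := ⟨rfl⟩

end EntireSpace

/-- The critical points of an entire function. -/
def criticalPoints (f : ℂ → ℂ) : Set ℂ := {z | deriv f z = 0}

/-- An entire function is typical if it is surjective and has infinitely many critical points,
all of them non-degenerate and with pairwise different values of `f` at them. -/
structure IsTypical (f : ℂ → ℂ) : Prop where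
  entire : Differentiable ℂ f
  surjective : Function.Surjective f
  infinite_criticalPoints : (criticalPoints f).Infinite
  nondegenerate : ∀ z ∈ criticalPoints f, deriv (deriv f) z ≠ 0
  injOn_criticalPoints : Set.InjOn f (criticalPoints f)

/-- The set `𝔗` of typical functions in `E_{ρ,p}`. -/
def typicalSet (ρ : ℕ+) (p : ℝ) : Set (EntireSpace ρ p) := {f | IsTypical f}

open Metric Topology Polynomial

/-! `E_{ρ,p}` is complete and its topology is generated by countably many seminorms, so it is a
Baire space. Typicality is then obtained as a countable intersection of open dense conditions, each
concerning a disk of radius `N`. Convergence in the space is locally uniform, also for derivatives.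
Hence non-degeneracy and separation of critical values, being inequalities over compact sets, are
open. Attaining a compact set of values, and having a critical point outside a disk, hold on a
neighbourhood of suitable polynomials by Hurwitz's theorem
(`TendstoLocallyUniformly.eventually_exists_eq`). Density rests on two perturbations. Polynomials
are dense because Taylor series converge in every weighted norm; nonconstant ones are surjective,
and a small multiple of a higher power of `z` creates a far critical point. For an arbitrary `f`,
all but countably many `a` make `f + a z` have non-degenerate critical points with distinct values
(`countable_degenerate`, `countable_coincident`). -/

/-! ### Isolated zeros, Hurwitz's theorem and linear perturbations -/

theorem Set.Countable.of_eventually_notMem {X : Type*} [TopologicalSpace X]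
    [SecondCountableTopology X] {S : Set X} (h : ∀ x ∈ S, ∀ᶠ y in 𝓝[≠] x, y ∉ S) :
    S.Countable := by
  refine (HereditarilyLindelofSpace.isLindelof S).countable_of_isDiscrete ?_
  rw [isDiscrete_iff_nhdsNE]
  intro x hx
  exact disjoint_iff.1 (Filter.disjoint_principal_right.2 (h x hx))

theorem Differentiable.countable_zeros {f : ℂ → ℂ} (hf : Differentiable ℂ f) {w : ℂ}
    (hw : f w ≠ 0) : {z | f z = 0}.Countable := by
  have ha : AnalyticOnNhd ℂ f Set.univ := fun z _ => hf.analyticAt z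
  refine Set.Countable.of_eventually_notMem fun z _ => ?_
  rcases (ha z trivial).eventually_eq_zero_or_eventually_ne_zero with h | h
  · exact absurd (ha.eqOn_zero_of_preconnected_of_eventuallyEq_zero isPreconnected_univ trivial h
      (Set.mem_univ w)) hw
  · exact h

/-- Hurwitz: if `F i → f` locally uniformly and the entire function `f` is not constant, then
near any point `z₀` the functions `F i` eventually attain all values close to `f z₀`. -/
theorem TendstoLocallyUniformly.eventually_exists_eq {ι : Type*} {l : Filter ι} {F : ι → ℂ → ℂ}
    {f : ℂ → ℂ} (h : TendstoLocallyUniformly F f l) (hF : ∀ i, Differentiable ℂ (F i))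
    (hf : Differentiable ℂ f) {z₀ w : ℂ} (hw : f w ≠ f z₀) {U : Set ℂ} (hU : U ∈ 𝓝 z₀) :
    ∀ᶠ q in l ×ˢ 𝓝 (f z₀), ∃ z ∈ U, F q.1 z = q.2 := by
  have ha : AnalyticOnNhd ℂ f Set.univ := fun z _ => hf.analyticAt z
  have hne : ∀ᶠ z in 𝓝[≠] z₀, f z ≠ f z₀ := by
    refine ((ha z₀ trivial).eventually_eq_or_eventually_ne analyticAt_const).resolve_left fun h' => ?_
    exact hw (ha.eqOn_of_preconnected_of_eventuallyEq analyticOnNhd_const isPreconnected_univ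
      trivial h' (Set.mem_univ w))
  obtain ⟨r, hr, hrU⟩ := nhds_basis_closedBall.mem_iff.1
    (Filter.inter_mem hU (eventually_nhdsWithin_iff.1 hne))
  have hS : ∀ z ∈ sphere z₀ r, 0 < ‖f z - f z₀‖ := fun z hz =>
    norm_sub_pos_iff.2 ((hrU (sphere_subset_closedBall hz)).2 (ne_of_mem_sphere hz hr.ne'))
  obtain ⟨x, hx, hmin⟩ := (isCompact_sphere z₀ r).exists_isMinOn
    (NormedSpace.sphere_nonempty.mpr hr.le)
    (f := fun z => ‖f z - f z₀‖) (by have := hf.continuous; fun_prop)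
  set ε := ‖f x - f z₀‖ with hε
  have hε0 : 0 < ε := hS x hx
  have hu := (tendstoLocallyUniformly_iff_forall_isCompact.1 h) _ (isCompact_closedBall z₀ r)
  rw [Metric.tendstoUniformlyOn_iff] at hu
  have h1 := hu (ε / 8) (by positivity)
  have h2 : ∀ᶠ c in 𝓝 (f z₀), dist c (f z₀) < ε / 8 := Metric.ball_mem_nhds _ (by positivity)
  filter_upwards [h1.prod_mk h2] with ⟨i, c⟩ ⟨hi, hc⟩
  have hi0 := hi z₀ (mem_closedBall_self hr.le)
  simp only [dist_eq_norm] at hi hc hi0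
  have hlow : ∀ z ∈ sphere z₀ r, ε / 2 ≤ ‖F i z - F i z₀‖ := by
    intro z hz
    have e1 : ε ≤ ‖f z - f z₀‖ := hmin hz
    have e2 := hi z (sphere_subset_closedBall hz)
    have e3 : f z - f z₀ = (f z - F i z) + (F i z - F i z₀) - (f z₀ - F i z₀) := by ring
    have e4 := norm_sub_le ((f z - F i z) + (F i z - F i z₀)) (f z₀ - F i z₀)
    have e5 := norm_add_le (f z - F i z) (F i z - F i z₀)
    rw [e3] at e1
    linarith
  -- The quantitative open mapping theorem needs `F i` not locally constant at `z₀`; by the identity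
  -- theorem that would contradict the lower bound on the circle.
  have hfreq : ∃ᶠ z in 𝓝 z₀, F i z ≠ F i z₀ := by
    by_contra h_freq
    have h' := Filter.not_frequently.1 h_freq
    simp only [not_not] at h'
    have hc : AnalyticOnNhd ℂ (F i) Set.univ := fun z _ => (hF i).analyticAt z
    have := hc.eqOn_of_preconnected_of_eventuallyEq analyticOnNhd_const isPreconnected_univ
      trivial h' (Set.mem_univ x)
    have h3 := hlow x hx
    rw [this, sub_self, norm_zero] at h3
    linarith
  -- Both `c` and `F i z₀` lie within `ε / 8` of `f z₀`, hence within `ε / 4` of each other.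
  obtain ⟨z, hz, hzc⟩ := (hF i).diffContOnCl.ball_subset_image_closedBall hr hlow hfreq
    (show c ∈ ball (F i z₀) (ε / 2 / 2) by
      rw [mem_ball_iff_norm]
      have := norm_add_le (c - f z₀) (f z₀ - F i z₀)
      rw [sub_add_sub_cancel] at this
      linarith)
  exact ⟨z, (hrU hz).1, hzc⟩

/-- For all but countably many `a`, the critical points of `z ↦ f z + a z` are non-degenerate. -/
theorem countable_degenerate {f : ℂ → ℂ} (hf : Differentiable ℂ f) :
    {a : ℂ | ∃ z, deriv f z + a = 0 ∧ deriv (deriv f) z = 0}.Countable := by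
  by_cases h : ∀ z, deriv (deriv f) z = 0
  · refine (Set.countable_singleton (-deriv f 0)).mono ?_
    rintro a ⟨z, hz, -⟩
    rw [is_const_of_deriv_eq_zero hf.deriv h z 0] at hz
    exact (neg_eq_of_add_eq_zero_right hz).symm
  · push Not at h
    obtain ⟨w, hw⟩ := h
    refine ((hf.deriv.deriv.countable_zeros hw).image fun z => -deriv f z).mono ?_
    rintro a ⟨z, hz, hz'⟩
    exact ⟨z, hz', neg_eq_of_add_eq_zero_right hz⟩

/-- For all but countably many `a`, the function `z ↦ f z + a z` takes distinct values at distinct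
non-degenerate critical points. -/
theorem countable_coincident {f : ℂ → ℂ} (hf : Differentiable ℂ f) :
    {a : ℂ | ∃ z w, z ≠ w ∧ deriv f z + a = 0 ∧ deriv f w + a = 0 ∧ deriv (deriv f) z ≠ 0 ∧
      deriv (deriv f) w ≠ 0 ∧ f z + a * z = f w + a * w}.Countable := by
  -- Substituting `a = -f' z` into the other two equations eliminates `a` and leaves `Φ (z, w) = 0`.
  let Φ : ℂ × ℂ → ℂ × ℂ := fun x =>
    (deriv f x.1 - deriv f x.2, f x.1 - f x.2 - deriv f x.1 * (x.1 - x.2))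
  let S : Set (ℂ × ℂ) := {x | x.1 ≠ x.2 ∧ deriv (deriv f) x.1 ≠ 0 ∧ deriv (deriv f) x.2 ≠ 0 ∧
    Φ x = 0}
  have hS : S.Countable := by
    refine Set.Countable.of_eventually_notMem ?_
    rintro ⟨z, w⟩ ⟨hzw, hz, hw, h0⟩
    have h0' : deriv f z = deriv f w := sub_eq_zero.1 (congrArg Prod.fst h0)
    have d1 : HasFDerivAt (fun x : ℂ × ℂ => x.1) (ContinuousLinearMap.fst ℂ ℂ ℂ) (z, w) :=
      hasFDerivAt_fst
    have d2 : HasFDerivAt (fun x : ℂ × ℂ => x.2) (ContinuousLinearMap.snd ℂ ℂ ℂ) (z, w) :=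
      hasFDerivAt_snd
    have f1 := (hf z).hasDerivAt.comp_hasFDerivAt (z, w) d1
    have f2 := (hf w).hasDerivAt.comp_hasFDerivAt (z, w) d2
    have g1 := (hf.deriv z).hasDerivAt.comp_hasFDerivAt (z, w) d1
    have g2 := (hf.deriv w).hasDerivAt.comp_hasFDerivAt (z, w) d2
    have hΦ := (g1.sub g2).prodMk ((f1.sub f2).sub (g1.mul (d1.sub d2)))
    have hne := hΦ.eventually_ne (c := 0) ?_
    · filter_upwards [hne] with x hx hxS
      exact hx hxS.2.2.2
    -- At a zero of `Φ` the differential sends `(u, v)` to `(f'' z u - f'' w v, -(z - w) f'' z u)`.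
    -- It is injective, so the zeros in `S` are isolated.
    · refine (LinearMap.exists_antilipschitzWith
        ((_ : ℂ × ℂ →L[ℂ] ℂ × ℂ) : ℂ × ℂ →ₗ[ℂ] ℂ × ℂ) ?_).imp fun K hK => hK.2
      rw [LinearMap.ker_eq_bot']
      rintro ⟨u, v⟩ huv
      have e1 := congrArg Prod.fst huv
      have e2 := congrArg Prod.snd huv
      simp only [ContinuousLinearMap.coe_coe, ContinuousLinearMap.prod_apply, sub_apply,
        add_apply, smul_apply, ContinuousLinearMap.coe_fst',
        ContinuousLinearMap.coe_snd', smul_eq_mul, Function.comp_apply, Pi.sub_apply,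
        Prod.fst_zero, Prod.snd_zero] at e1 e2
      have hu : (z - w) * (deriv (deriv f) z * u) = 0 := by
        linear_combination -e2 + v * h0'
      have hu0 : u = 0 := by simpa [sub_ne_zero.2 hzw, hz] using hu
      have hv0 : v = 0 := by simpa [hu0, hw] using e1
      rw [hu0, hv0, Prod.mk_zero_zero]
  refine (hS.image fun x => -deriv f x.1).mono ?_
  rintro a ⟨z, w, hzw, hz, hw, hz', hw', heq⟩
  refine ⟨(z, w), ⟨hzw, hz', hw', ?_⟩, neg_eq_of_add_eq_zero_right hz⟩
  have ha : a = -deriv f z := (neg_eq_of_add_eq_zero_right hz).symm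
  refine Prod.ext ?_ ?_
  · change deriv f z - deriv f w = 0
    linear_combination hz - hw
  · change f z - f w - deriv f z * (z - w) = 0
    linear_combination heq - hz * (z - w)

/-! ### Topology of the space and continuity of evaluation -/

namespace EntireSpace

variable {ρ : ℕ+} {p : ℝ}

instance : IsTopologicalAddGroup (EntireSpace ρ p) := withSeminorms.topologicalAddGroup

instance : ContinuousSMul ℂ (EntireSpace ρ p) := withSeminorms.continuousSMul

instance : FirstCountableTopology (EntireSpace ρ p) := withSeminorms.firstCountableTopology

theorem differentiable (f : EntireSpace ρ p) : Differentiable ℂ f := f.2.1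

theorem norm_apply_le (n : ℕ+) (f : EntireSpace ρ p) (z : ℂ) :
    ‖f z‖ ≤ wnorm ρ p n f * Real.exp ((p + 1 / (n : ℝ)) * ‖z‖ ^ (ρ : ℕ)) := by
  have h := le_ciSup (bddAbove_weight_mul_norm n f) z
  rw [← wnorm_apply, weight, neg_mul, Real.exp_neg, inv_mul_le_iff₀ (Real.exp_pos _)] at h
  rwa [mul_comm]

theorem wnorm_le (n : ℕ+) (f : EntireSpace ρ p) {M : ℝ}
    (h : ∀ z, ‖f z‖ ≤ M * Real.exp ((p + 1 / (n : ℝ)) * ‖z‖ ^ (ρ : ℕ))) : wnorm ρ p n f ≤ M := by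
  rw [wnorm_apply]
  refine ciSup_le fun z => ?_
  rw [weight, neg_mul, Real.exp_neg, inv_mul_le_iff₀ (Real.exp_pos _), mul_comm]
  exact h z

theorem sub_apply (f g : EntireSpace ρ p) (z : ℂ) : (f - g) z = f z - g z := rfl

theorem exists_forall_norm_le_of_isCompact {K : Set ℂ} (hK : IsCompact K) :
    ∃ C > 0, ∀ f : EntireSpace ρ p, ∀ z ∈ K, ‖f z‖ ≤ wnorm ρ p 1 f * C := by
  obtain ⟨B, hB⟩ := hK.bddAbove_image
    (f := fun z : ℂ => Real.exp ((p + 1 / ((1 : ℕ+) : ℝ)) * ‖z‖ ^ (ρ : ℕ))) (by fun_prop)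
  refine ⟨max B 1, by positivity, fun f z hz => (norm_apply_le 1 f z).trans ?_⟩
  exact mul_le_mul_of_nonneg_left ((hB ⟨z, hz, rfl⟩).trans (le_max_left _ _)) (apply_nonneg _ _)

/-- Convergence in `E_{ρ,p}` implies locally uniform convergence. -/
theorem tendstoLocallyUniformly_nhds (f : EntireSpace ρ p) :
    TendstoLocallyUniformly (fun g : EntireSpace ρ p => (g : ℂ → ℂ)) f (𝓝 f) := by
  rw [tendstoLocallyUniformly_iff_forall_isCompact]
  intro K hK
  rw [Metric.tendstoUniformlyOn_iff]
  intro ε hε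
  obtain ⟨C, hC, h⟩ := exists_forall_norm_le_of_isCompact (ρ := ρ) (p := p) hK
  have ht := (withSeminorms.tendsto_nhds (id : EntireSpace ρ p → _) f).1 tendsto_id 1 (ε / C)
    (by positivity)
  filter_upwards [ht] with g hg z hz
  rw [dist_comm, dist_eq_norm, ← sub_apply]
  exact (h _ z hz).trans_lt ((lt_div_iff₀ hC).1 hg)

theorem tendstoLocallyUniformly_deriv_nhds (f : EntireSpace ρ p) :
    TendstoLocallyUniformly (fun g : EntireSpace ρ p => deriv (g : ℂ → ℂ)) (deriv f) (𝓝 f) := by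
  rw [← tendstoLocallyUniformlyOn_univ]
  exact (tendstoLocallyUniformlyOn_univ.2 (tendstoLocallyUniformly_nhds f)).deriv
    (Eventually.of_forall fun g => g.differentiable.differentiableOn) isOpen_univ

theorem tendstoLocallyUniformly_deriv_deriv_nhds (f : EntireSpace ρ p) :
    TendstoLocallyUniformly (fun g : EntireSpace ρ p => deriv (deriv (g : ℂ → ℂ)))
      (deriv (deriv f)) (𝓝 f) := by
  rw [← tendstoLocallyUniformlyOn_univ]
  exact (tendstoLocallyUniformlyOn_univ.2 (tendstoLocallyUniformly_deriv_nhds f)).deriv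
    (Eventually.of_forall fun g => g.differentiable.deriv.differentiableOn) isOpen_univ

theorem continuous_eval : Continuous fun x : EntireSpace ρ p × ℂ => x.1 x.2 := by
  refine continuous_iff_continuousAt.2 fun x => ?_
  rw [ContinuousAt, nhds_prod_eq]
  have h := (tendstoLocallyUniformly_nhds x.1)
  -- The family is reindexed by the product filter, so that function and point vary together.
  exact TendstoLocallyUniformly.tendsto_comp
    (fun u hu y => (h u hu y).imp fun t ht => ⟨ht.1, tendsto_fst.eventually ht.2⟩)
    x.1.differentiable.continuous.continuousAt tendsto_snd

theorem continuous_eval_deriv : Continuous fun x : EntireSpace ρ p × ℂ => deriv x.1 x.2 := by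
  refine continuous_iff_continuousAt.2 fun x => ?_
  rw [ContinuousAt, nhds_prod_eq]
  have h := (tendstoLocallyUniformly_deriv_nhds x.1)
  exact TendstoLocallyUniformly.tendsto_comp
    (fun u hu y => (h u hu y).imp fun t ht => ⟨ht.1, tendsto_fst.eventually ht.2⟩)
    x.1.differentiable.deriv.continuous.continuousAt tendsto_snd

theorem continuous_eval_deriv_deriv :
    Continuous fun x : EntireSpace ρ p × ℂ => deriv (deriv x.1) x.2 := by
  refine continuous_iff_continuousAt.2 fun x => ?_
  rw [ContinuousAt, nhds_prod_eq]
  have h := (tendstoLocallyUniformly_deriv_deriv_nhds x.1)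
  exact TendstoLocallyUniformly.tendsto_comp
    (fun u hu y => (h u hu y).imp fun t ht => ⟨ht.1, tendsto_fst.eventually ht.2⟩)
    x.1.differentiable.deriv.deriv.continuous.continuousAt tendsto_snd

/-! ### Completeness and the Baire property -/

/-- A sequence that is Cauchy for all the weighted norms converges in `E_{ρ,p}`. -/
theorem exists_tendsto_of_cauchy {u : ℕ → EntireSpace ρ p}
    (hu : ∀ n, ∀ ε > 0, ∃ N, ∀ i ≥ N, ∀ j ≥ N, wnorm ρ p n (u i - u j) < ε) :
    ∃ f, Tendsto u atTop (𝓝 f) := by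
  have hpt : ∀ z, ∃ w, Tendsto (fun i => u i z) atTop (𝓝 w) := by
    intro z
    refine cauchySeq_tendsto_of_complete (Metric.cauchySeq_iff.2 fun ε hε => ?_)
    have hE := Real.exp_pos ((p + 1 / ((1 : ℕ+) : ℝ)) * ‖z‖ ^ (ρ : ℕ))
    obtain ⟨N, hN⟩ := hu 1 (ε / Real.exp ((p + 1 / ((1 : ℕ+) : ℝ)) * ‖z‖ ^ (ρ : ℕ)))
      (by positivity)
    refine ⟨N, fun i hi j hj => ?_⟩
    rw [dist_eq_norm, ← sub_apply]
    exact (norm_apply_le 1 _ z).trans_lt ((lt_div_iff₀ hE).1 (hN i hi j hj))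
  choose g hg using hpt
  have hlim : ∀ (n : ℕ+), ∀ ε > 0, ∃ N, ∀ i ≥ N, ∀ z,
      ‖u i z - g z‖ ≤ ε * Real.exp ((p + 1 / (n : ℝ)) * ‖z‖ ^ (ρ : ℕ)) := by
    intro n ε hε
    obtain ⟨N, hN⟩ := hu n ε hε
    refine ⟨N, fun i hi z => ?_⟩
    refine le_of_tendsto ((tendsto_const_nhds.sub (hg z)).norm) ?_
    filter_upwards [eventually_ge_atTop N] with j hj
    rw [← sub_apply]
    exact (norm_apply_le n _ z).trans
      (mul_le_mul_of_nonneg_right (hN i hi j hj).le (Real.exp_pos _).le)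
  have hdiff : Differentiable ℂ g := by
    rw [← differentiableOn_univ]
    refine TendstoLocallyUniformlyOn.differentiableOn (φ := atTop) (F := fun i => (u i : ℂ → ℂ)) ?_
      (Eventually.of_forall fun i => (u i).differentiable.differentiableOn) isOpen_univ
    rw [tendstoLocallyUniformlyOn_univ, tendstoLocallyUniformly_iff_forall_isCompact]
    intro K hK
    rw [Metric.tendstoUniformlyOn_iff]
    intro ε hε
    obtain ⟨B, hB⟩ := hK.bddAbove_image
      (f := fun z : ℂ => Real.exp ((p + 1 / ((1 : ℕ+) : ℝ)) * ‖z‖ ^ (ρ : ℕ))) (by fun_prop)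
    have hB1 : 0 < max B 1 := by positivity
    obtain ⟨N, hN⟩ := hlim 1 (ε / 2 / max B 1) (by positivity)
    filter_upwards [eventually_ge_atTop N] with i hi z hz
    rw [dist_comm, dist_eq_norm]
    have hBz := (hB ⟨z, hz, rfl⟩).trans (le_max_left B 1)
    calc _ ≤ _ := hN i hi z
      _ ≤ ε / 2 / max B 1 * max B 1 := by gcongr
      _ = ε / 2 := by field_simp
      _ < ε := half_lt_self hε
  have hord : HasOrderType ρ p g := by
    rw [hasOrderType_iff]
    intro ε hε
    -- One approximant `u N`, close in a single norm of index `m + 1 > 2 / ε`, already controls the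
    -- growth of `g`.
    obtain ⟨m, hm⟩ := exists_nat_one_div_lt (half_pos hε)
    obtain ⟨N, hN⟩ := hlim m.succPNat 1 one_pos
    filter_upwards [eventually_mul_exp_le ρ p (wnorm ρ p m.succPNat (u N) + 1) hε] with z hz
    refine le_trans ?_ hz
    have h1 := hN N le_rfl z
    have h2 := norm_apply_le m.succPNat (u N) z
    have h3 : ‖g z‖ ≤ ‖u N z‖ + ‖u N z - g z‖ := by
      simpa using norm_sub_le (u N z) (u N z - g z)
    have h4 : Real.exp ((p + 1 / ((m.succPNat : ℕ+) : ℝ)) * ‖z‖ ^ (ρ : ℕ)) ≤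
        Real.exp ((p + ε / 2) * ‖z‖ ^ (ρ : ℕ)) := by
      rw [Nat.succPNat_coe, Nat.cast_succ]
      gcongr
    have h5 : 0 ≤ wnorm ρ p m.succPNat (u N) := apply_nonneg _ _
    calc ‖g z‖ ≤ (wnorm ρ p m.succPNat (u N) + 1) *
          Real.exp ((p + 1 / ((m.succPNat : ℕ+) : ℝ)) * ‖z‖ ^ (ρ : ℕ)) := by linarith
      _ ≤ _ := by gcongr
  let f : EntireSpace ρ p := ⟨g, hdiff, hord⟩
  refine ⟨f, (withSeminorms.tendsto_nhds u f).2 fun n ε hε => ?_⟩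
  obtain ⟨N, hN⟩ := hlim n (ε / 2) (half_pos hε)
  filter_upwards [eventually_ge_atTop N] with i hi
  exact (wnorm_le n _ fun z => hN i hi z).trans_lt (half_lt_self hε)

instance : BaireSpace (EntireSpace ρ p) := by
  let _ : UniformSpace (EntireSpace ρ p) := IsTopologicalAddGroup.rightUniformSpace _
  have : IsUniformAddGroup (EntireSpace ρ p) := isUniformAddGroup_of_addCommGroup
  have : (uniformity (EntireSpace ρ p)).IsCountablyGenerated :=
    IsUniformAddGroup.uniformity_countably_generated
  have : CompleteSpace (EntireSpace ρ p) := by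
    refine UniformSpace.complete_of_cauchySeq_tendsto fun u hu => exists_tendsto_of_cauchy ?_
    intro n ε hε
    have hball : {f : EntireSpace ρ p | wnorm ρ p n f < ε} ∈ 𝓝 (0 : EntireSpace ρ p) := by
      have hc := (withSeminorms (ρ := ρ) (p := p)).continuous_seminorm n
      exact (isOpen_lt hc continuous_const).mem_nhds (by simpa using hε)
    rw [_root_.cauchySeq_iff] at hu
    have hV : {x : EntireSpace ρ p × EntireSpace ρ p | wnorm ρ p n (x.1 - x.2) < ε} ∈
        uniformity (EntireSpace ρ p) := by
      rw [uniformity_eq_comap_nhds_zero_swapped]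
      exact ⟨_, hball, fun x hx => hx⟩
    obtain ⟨N, hN⟩ := hu _ hV
    exact ⟨N, fun i hi j hj => hN i hi j hj⟩
  infer_instance

/-! ### Density of polynomials -/

theorem polynomial_mem_entireSubmodule (ρ : ℕ+) (hp : 0 < p) (P : ℂ[X]) :
    (fun z => P.eval z) ∈ entireSubmodule ρ p := by
  induction P using Polynomial.induction_on' with
  | add P Q hP hQ => simpa only [eval_add] using! add_mem hP hQ
  | monomial k a =>
    have hk : (fun z : ℂ => z ^ k) ∈ entireSubmodule ρ p := by
      refine ⟨differentiable_id.pow k, (hasOrderType_iff _ _ _).2 fun ε hε => ?_⟩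
      have ho := ((isLittleO_pow_exp_pos_mul_atTop k (add_pos hp hε)).comp_tendsto
        (tendsto_norm_pow_cobounded ρ)).bound one_pos
      filter_upwards [ho, tendsto_norm_cobounded_atTop.eventually_ge_atTop 1] with z hz hz1
      simp only [Function.comp_apply, Real.norm_eq_abs, Real.abs_exp, one_mul] at hz
      rw [norm_pow]
      refine (pow_le_pow_left₀ (norm_nonneg z) (le_self_pow₀ hz1 ρ.ne_zero) k).trans ?_
      exact (le_abs_self _).trans hz
    have := (entireSubmodule ρ p).smul_mem a hk
    simpa only [eval_monomial] using! this

/-- A polynomial as an element of `E_{ρ,p}`. -/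
noncomputable def ofPolynomial (ρ : ℕ+) (hp : 0 < p) (P : ℂ[X]) : EntireSpace ρ p :=
  ⟨fun z => P.eval z, polynomial_mem_entireSubmodule ρ hp P⟩

theorem ofPolynomial_add_C_mul (hp : 0 < p) (P Q : ℂ[X]) (a : ℂ) :
    ofPolynomial ρ hp (P + C a * Q) = ofPolynomial ρ hp P + a • ofPolynomial ρ hp Q := by
  apply Subtype.ext
  funext z
  change eval z (P + C a * Q) = eval z P + a * eval z Q
  simp

theorem deriv_ofPolynomial (hp : 0 < p) (P : ℂ[X]) (z : ℂ) :
    deriv (ofPolynomial ρ hp P) z = (derivative P).eval z :=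
  P.deriv

/-- Cauchy estimates for the Taylor coefficients. -/
theorem norm_taylorCoeff_mul_pow_le (n : ℕ+) (f : EntireSpace ρ p) (k : ℕ) {r : ℝ} (hr : 0 ≤ r) :
    ‖(k.factorial : ℂ)⁻¹ * iteratedDeriv k f 0‖ * r ^ k ≤
      wnorm ρ p n f * Real.exp ((p + 1 / (n : ℝ)) * r ^ (ρ : ℕ)) := by
  rcases hr.eq_or_lt with rfl | hr
  · rcases Nat.eq_zero_or_pos k with rfl | hk
    · simpa using norm_apply_le n f 0
    · rw [zero_pow hk.ne', mul_zero]
      exact mul_nonneg (apply_nonneg _ _) (Real.exp_pos _).le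
  · have h := Complex.norm_iteratedDeriv_le_of_forall_mem_sphere_norm_le k hr
      (f.differentiable.diffContOnCl (s := ball 0 r)) (fun z hz => by
        have := norm_apply_le n f z
        rwa [mem_sphere_zero_iff_norm.1 hz] at this)
    have hk : (0 : ℝ) < k.factorial := by exact_mod_cast k.factorial_pos
    rw [norm_mul, norm_inv, Complex.norm_natCast]
    rw [le_div_iff₀ (by positivity)] at h
    rw [inv_mul_eq_div, div_mul_eq_mul_div, div_le_iff₀ hk]
    linarith

/-- The Taylor polynomials at `0`. -/
noncomputable def taylorPolynomial (f : EntireSpace ρ p) (m : ℕ) : ℂ[X] :=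
  ∑ k ∈ Finset.range m, C ((k.factorial : ℂ)⁻¹ * iteratedDeriv k f 0) * X ^ k

/-- The room between the exponents of the norms `n + 1` and `n` yields geometric decay: Cauchy's
estimate in the norm `n + 1`, on the circle of radius `‖z‖ / s` with `s ^ ρ = q / q'`, bounds the
`k`-th Taylor term by `s ^ k` times the growth allowed in the norm `n`. -/
theorem exists_wnorm_sub_taylorPolynomial_le (hp : 0 < p) (n : ℕ+) (f : EntireSpace ρ p) :
    ∃ s B : ℝ, 0 < s ∧ s < 1 ∧
      ∀ m, wnorm ρ p n (ofPolynomial ρ hp (taylorPolynomial f m) - f) ≤ B * s ^ m := by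
  have hn : (0 : ℝ) < n := by exact_mod_cast n.pos
  set q := p + 1 / ((n + 1 : ℕ+) : ℝ) with hq
  set q' := p + 1 / (n : ℝ) with hq'
  have hq0 : 0 < q := by positivity
  have hqq : q < q' := by
    rw [hq, hq', PNat.add_coe, PNat.one_coe, Nat.cast_add, Nat.cast_one]
    gcongr
    linarith
  have hq'0 : 0 < q' := hq0.trans hqq
  set s : ℝ := (q / q') ^ ((ρ : ℝ)⁻¹) with hs
  have hs0 : 0 < s := Real.rpow_pos_of_pos (by positivity) _
  have hs1 : s < 1 := Real.rpow_lt_one (by positivity) ((div_lt_one hq'0).2 hqq)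
    (by have : (0 : ℝ) < ρ := by exact_mod_cast ρ.pos
        positivity)
  have hsρ : s ^ (ρ : ℕ) = q / q' := Real.rpow_inv_natCast_pow (by positivity) ρ.ne_zero
  set M := wnorm ρ p (n + 1) f
  refine ⟨s, M * (1 - s)⁻¹, hs0, hs1, fun m => wnorm_le n _ fun z => ?_⟩
  set c : ℕ → ℂ := fun k => (k.factorial : ℂ)⁻¹ * iteratedDeriv k f 0 with hc
  have hterm : ∀ k, ‖c k * z ^ k‖ ≤ M * Real.exp (q' * ‖z‖ ^ (ρ : ℕ)) * s ^ k := by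
    intro k
    have h := norm_taylorCoeff_mul_pow_le (n + 1) f k (r := ‖z‖ / s) (by positivity)
    have he : q * (‖z‖ / s) ^ (ρ : ℕ) = q' * ‖z‖ ^ (ρ : ℕ) := by
      rw [div_pow, hsρ]
      field_simp
    rw [← hq, he, div_pow, ← mul_div_assoc, div_le_iff₀ (by positivity)] at h
    rwa [norm_mul, norm_pow]
  have hsum : HasSum (fun k => c k * z ^ k) (f z) := by
    have := Complex.hasSum_taylorSeries_of_entire f.differentiable 0 z
    simpa [hc, smul_eq_mul, mul_comm, mul_left_comm, mul_assoc] using this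
  have htail := (hasSum_nat_add_iff' m).2 hsum
  have hgeo : HasSum (fun k => M * Real.exp (q' * ‖z‖ ^ (ρ : ℕ)) * s ^ (k + m))
      (M * Real.exp (q' * ‖z‖ ^ (ρ : ℕ)) * s ^ m * (1 - s)⁻¹) := by
    refine ((hasSum_geometric_of_lt_one hs0.le hs1).mul_left
      (M * Real.exp (q' * ‖z‖ ^ (ρ : ℕ)) * s ^ m)).congr_fun fun k => ?_
    ring
  have hb := htail.norm_le_of_bounded hgeo fun k => hterm (k + m)
  have hval : (ofPolynomial ρ hp (taylorPolynomial f m) - f) z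
      = -(f z - ∑ k ∈ Finset.range m, c k * z ^ k) := by
    rw [sub_apply]
    change eval z (taylorPolynomial f m) - f z = _
    rw [taylorPolynomial, eval_finsetSum]
    simp [hc]
  rw [hval, norm_neg]
  refine hb.trans (le_of_eq ?_)
  ring

theorem dense_range_ofPolynomial (hp : 0 < p) :
    Dense (Set.range (ofPolynomial ρ hp)) := by
  intro f
  have ht : Tendsto (fun m => ofPolynomial ρ hp (taylorPolynomial f m)) atTop (𝓝 f) := by
    refine (withSeminorms.tendsto_nhds _ f).2 fun n ε hε => ?_
    obtain ⟨s, B, hs0, hs1, h⟩ := exists_wnorm_sub_taylorPolynomial_le hp n f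
    have hlim : Tendsto (fun m => B * s ^ m) atTop (𝓝 0) := by
      simpa using (tendsto_pow_atTop_nhds_zero_of_lt_one hs0.le hs1).const_mul B
    filter_upwards [hlim.eventually_lt_const hε] with m hm
    exact (h m).trans_lt hm
  exact mem_closure_of_tendsto ht (Eventually.of_forall fun m => ⟨_, rfl⟩)

/-- `a ↦ f + a • g` is continuous at `0`, phrased for a net of scalars. -/
theorem tendsto_add_smul {ι : Type*} {l : Filter ι} {a : ι → ℂ} (ha : Tendsto a l (𝓝 0))
    (f g : EntireSpace ρ p) : Tendsto (fun i => f + a i • g) l (𝓝 f) := by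
  simpa using tendsto_const_nhds.add (ha.smul_const g)

theorem dense_nonconstant_polynomials (hp : 0 < p) :
    Dense (ofPolynomial ρ hp '' {P | P.natDegree ≠ 0}) := by
  refine (dense_range_ofPolynomial hp).closure.mono ?_ |>.of_closure
  refine closure_minimal ?_ isClosed_closure
  rintro _ ⟨P, rfl⟩
  by_cases hP : P.natDegree = 0
  · have hlim := tendsto_add_smul (ρ := ρ) (p := p) (tendsto_one_div_add_atTop_nhds_zero_nat (𝕜 := ℂ))
      (ofPolynomial ρ hp P) (ofPolynomial ρ hp X)
    refine mem_closure_of_tendsto hlim (Eventually.of_forall fun m => ?_)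
    refine ⟨_, ?_, ofPolynomial_add_C_mul hp P X _⟩
    have hm : (1 / ((m : ℂ) + 1)) ≠ 0 := one_div_ne_zero (by exact_mod_cast m.succ_ne_zero)
    rw [Set.mem_ofPred_eq, natDegree_add_eq_right_of_natDegree_lt, natDegree_C_mul_X _ hm]
    · exact one_ne_zero
    · rw [natDegree_C_mul_X _ hm, hP]
      exact one_pos
  · exact subset_closure ⟨P, hP, rfl⟩

/-! ### Surjectivity and critical points far away -/

/-- A nonconstant polynomial attains every value. By Hurwitz, nearby functions attain all values
near a given one, and compactness of the disk makes the neighbourhood uniform. -/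
theorem dense_interior_closedBall_subset_range (ρ : ℕ+) (hp : 0 < p) (R : ℝ) :
    Dense (interior {f : EntireSpace ρ p | closedBall 0 R ⊆ Set.range f}) := by
  refine (dense_nonconstant_polynomials hp).mono ?_
  rintro _ ⟨P, hP, rfl⟩
  have hsurj : Function.Surjective (ofPolynomial ρ hp P) :=
    (P.isOpenQuotientMap_eval hP).surjective
  rw [mem_interior_iff_mem_nhds]
  refine (isCompact_closedBall (0 : ℂ) R).eventually_forall_of_forall_eventually
    (P := fun (f : EntireSpace ρ p) c => c ∈ Set.range f) fun c _ => ?_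
  obtain ⟨z, rfl⟩ := hsurj c
  obtain ⟨w, hw⟩ := hsurj (ofPolynomial ρ hp P z + 1)
  rw [nhds_prod_eq]
  filter_upwards [(tendstoLocallyUniformly_nhds _).eventually_exists_eq (fun g => g.differentiable)
    (differentiable _) (z₀ := z) (w := w) (by simp [hw]) univ_mem] with q hq
  obtain ⟨y, -, hy⟩ := hq
  exact ⟨y, hy⟩

theorem _root_.Polynomial.exists_norm_eval_le (Q : ℂ[X]) :
    ∃ B, 0 ≤ B ∧ ∀ z : ℂ, 1 ≤ ‖z‖ → ‖Q.eval z‖ ≤ B * ‖z‖ ^ Q.natDegree := by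
  refine ⟨∑ i ∈ Finset.range (Q.natDegree + 1), ‖Q.coeff i‖, by positivity, fun z hz => ?_⟩
  rw [eval_eq_sum_range, Finset.sum_mul]
  refine (norm_sum_le _ _).trans (Finset.sum_le_sum fun i hi => ?_)
  rw [norm_mul, norm_pow]
  gcongr
  exact Nat.lt_succ_iff.1 (Finset.mem_range.1 hi)

theorem dense_interior_exists_criticalPoint (ρ : ℕ+) (hp : 0 < p) (R : ℝ) :
    Dense (interior {f : EntireSpace ρ p | ∃ z ∈ criticalPoints f, R < ‖z‖}) := by
  refine (dense_nonconstant_polynomials hp).closure.mono ?_ |>.of_closure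
  refine closure_minimal ?_ isClosed_closure
  rintro _ ⟨P, hP, rfl⟩
  set Q := derivative P with hQ
  have hQ0 : Q ≠ 0 := fun h => hP (derivative_eq_zero.1 h)
  set d := Q.natDegree with hd
  obtain ⟨B, hB0, hB⟩ := Q.exists_norm_eval_le
  -- This choice makes the derivative of `P + a k X ^ (d + 2)` vanish at `k`. The new term has
  -- derivative of degree `d + 1`, above `deg Q = d`, which forces `a k = O(1 / k)`.
  let a : ℕ → ℂ := fun k => -Q.eval (k : ℂ) / ((d + 2 : ℕ) * (k : ℂ) ^ (d + 1))
  have ha : Tendsto a atTop (𝓝 0) := by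
    refine squeeze_zero_norm' ?_ (tendsto_const_div_atTop_nhds_zero_nat B)
    filter_upwards [eventually_ge_atTop 1] with k hk
    have hk1 : (1 : ℝ) ≤ k := by exact_mod_cast hk
    have hk' := hB k (by simpa using hk1)
    rw [Complex.norm_natCast] at hk'
    simp only [a]
    rw [norm_div, norm_neg, norm_mul, norm_pow, Complex.norm_natCast, Complex.norm_natCast,
      div_le_div_iff₀ (by positivity) (by positivity)]
    calc ‖eval (k : ℂ) Q‖ * k ≤ B * (k : ℝ) ^ d * k := by gcongr
      _ = B * (1 * (k : ℝ) ^ (d + 1)) := by ring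
      _ ≤ B * ((d + 2 : ℕ) * (k : ℝ) ^ (d + 1)) := by
        gcongr
        exact_mod_cast (by lia : 1 ≤ d + 2)
  refine mem_closure_of_tendsto (tendsto_add_smul ha (ofPolynomial ρ hp P)
    (ofPolynomial ρ hp (X ^ (d + 2)))) ?_
  filter_upwards [eventually_ge_atTop 1, tendsto_natCast_atTop_atTop.eventually_gt_atTop R]
    with k hk hkR
  rw [← ofPolynomial_add_C_mul, mem_interior_iff_mem_nhds]
  set T := P + C (a k) * X ^ (d + 2) with hT
  have hT' : derivative T = Q + C (a k * (d + 2 : ℕ)) * X ^ (d + 1) := by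
    rw [hT, derivative_add, derivative_C_mul_X_pow]
    rfl
  have hk0 : (k : ℂ) ≠ 0 := by exact_mod_cast (by lia : k ≠ 0)
  have hd0 : ((d + 2 : ℕ) : ℂ) ≠ 0 := by exact_mod_cast (by lia : d + 2 ≠ 0)
  have hzero : deriv (ofPolynomial ρ hp T) k = 0 := by
    rw [deriv_ofPolynomial, hT']
    simp only [eval_add, eval_mul, eval_C, eval_pow, eval_X, a]
    field_simp
    ring
  -- Hurwitz needs `T'` nonconstant; as `T'` vanishes at `k`, it suffices that it is not identically
  -- zero.
  have hT0 : derivative T ≠ 0 := by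
    intro h
    have hcoeff : Q.coeff (d + 1) = 0 := coeff_eq_zero_of_natDegree_lt (Nat.lt_succ_self _)
    have h1 := congrArg (fun S => coeff S (d + 1)) h
    simp only [hT', coeff_add, hcoeff, coeff_C_mul_X_pow, if_true, zero_add, coeff_zero] at h1
    rw [hT', h1, C_0, zero_mul, add_zero] at h
    exact hQ0 h
  obtain ⟨w, hw⟩ : ∃ w, (derivative T).eval w ≠ 0 := by
    by_contra! h
    exact hT0 (Polynomial.funext fun w => by simpa using h w)
  have hU : {z : ℂ | R < ‖z‖} ∈ 𝓝 (k : ℂ) :=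
    (isOpen_lt continuous_const continuous_norm).mem_nhds (by simpa using hkR)
  have hev := (tendstoLocallyUniformly_deriv_nhds (ofPolynomial ρ hp T)).eventually_exists_eq
    (fun g => g.differentiable.deriv) (differentiable _).deriv (z₀ := k) (w := w)
    (by rwa [hzero, deriv_ofPolynomial]) hU
  rw [hzero] at hev
  filter_upwards [hev.curry] with g hg
  obtain ⟨z, hzU, hz⟩ := hg.self_of_nhds
  exact ⟨z, hz, hzU⟩

/-! ### Non-degeneracy and separation of critical values -/

theorem _root_.IsCompact.isOpen_setOf_forall_mem {X Y : Type*} [TopologicalSpace X]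
    [TopologicalSpace Y] {K : Set Y} (hK : IsCompact K) {U : Set (X × Y)} (hU : IsOpen U) :
    IsOpen {x | ∀ y ∈ K, (x, y) ∈ U} :=
  isOpen_iff_eventually.2 fun _ hx =>
    hK.eventually_forall_of_forall_eventually fun y hy => hU.mem_nhds (hx y hy)

/-- Functions all of whose critical points in a closed disk are non-degenerate. -/
def nondegenerateOn (ρ : ℕ+) (p R : ℝ) : Set (EntireSpace ρ p) :=
  {f | ∀ z ∈ closedBall (0 : ℂ) R, deriv f z ≠ 0 ∨ deriv (deriv f) z ≠ 0}

theorem isOpen_nondegenerateOn (R : ℝ) : IsOpen (nondegenerateOn ρ p R) :=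
  (isCompact_closedBall (0 : ℂ) R).isOpen_setOf_forall_mem
    (U := {x : EntireSpace ρ p × ℂ | deriv x.1 x.2 ≠ 0 ∨ deriv (deriv x.1) x.2 ≠ 0})
    ((isOpen_ne_fun continuous_eval_deriv continuous_const).union
      (isOpen_ne_fun continuous_eval_deriv_deriv continuous_const))

/-- Functions which take different values at critical points in a closed disk whose distance is
at least `δ`. -/
def separatedOn (ρ : ℕ+) (p R δ : ℝ) : Set (EntireSpace ρ p) :=
  {f | ∀ x ∈ (closedBall (0 : ℂ) R ×ˢ closedBall (0 : ℂ) R) ∩ {x | δ ≤ dist x.1 x.2},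
    deriv f x.1 ≠ 0 ∨ deriv f x.2 ≠ 0 ∨ f x.1 ≠ f x.2}

theorem isOpen_separatedOn (R δ : ℝ) : IsOpen (separatedOn ρ p R δ) := by
  have h1 : Continuous fun x : EntireSpace ρ p × ℂ × ℂ => (x.1, x.2.1) := by fun_prop
  have h2 : Continuous fun x : EntireSpace ρ p × ℂ × ℂ => (x.1, x.2.2) := by fun_prop
  -- Requiring `δ ≤ dist` removes the diagonal, where the values trivially agree, yet keeps the set
  -- of pairs compact.
  exact (((isCompact_closedBall (0 : ℂ) R).prod (isCompact_closedBall (0 : ℂ) R)).inter_right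
    (isClosed_le continuous_const (by fun_prop))).isOpen_setOf_forall_mem
    (U := {x : EntireSpace ρ p × ℂ × ℂ | deriv x.1 x.2.1 ≠ 0 ∨ deriv x.1 x.2.2 ≠ 0 ∨
      x.1 x.2.1 ≠ x.1 x.2.2})
    ((isOpen_ne_fun (continuous_eval_deriv.comp h1) continuous_const).union
      ((isOpen_ne_fun (continuous_eval_deriv.comp h2) continuous_const).union
        (isOpen_ne_fun (continuous_eval.comp h1) (continuous_eval.comp h2))))

/-- Functions with non-degenerate critical points and distinct critical values are dense. -/
theorem dense_nondegenerate_injOn (ρ : ℕ+) (hp : 0 < p) :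
    Dense {f : EntireSpace ρ p | (∀ z ∈ criticalPoints f, deriv (deriv f) z ≠ 0) ∧
      Set.InjOn f (criticalPoints f)} := by
  intro f
  set g := ofPolynomial ρ hp X
  have hd := ((countable_degenerate f.differentiable).union
    (countable_coincident f.differentiable)).dense_compl ℂ
  have hcont : Continuous fun a : ℂ => f + a • g := by fun_prop
  have h0 : f + (0 : ℂ) • g = f := by simp
  rw [← h0]
  refine map_mem_closure (f := fun a : ℂ => f + a • g) hcont (hd 0) fun a ha => ?_
  have hfun : ((f + a • g : EntireSpace ρ p) : ℂ → ℂ) = fun z => f z + a * z := by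
    funext z
    change f z + a * eval z X = _
    rw [eval_X]
  have hder : deriv (fun z => f z + a * z) = fun z => deriv f z + a := by
    funext z
    have := (f.differentiable z).hasDerivAt.add ((hasDerivAt_id z).const_mul a)
    rw [mul_one] at this
    exact this.deriv
  have hder2 : deriv (fun z => deriv f z + a) = deriv (deriv f) := by
    funext z
    rw [deriv_add_const]
  have hnd : ∀ z, deriv f z + a = 0 → deriv (deriv f) z ≠ 0 := fun z hz hz' =>
    ha (Or.inl ⟨z, hz, hz'⟩)
  simp only [Set.mem_ofPred_eq, criticalPoints, hfun, hder, hder2]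
  refine ⟨hnd, fun z hz w hw hzw => ?_⟩
  by_contra hne
  exact ha (Or.inr ⟨z, w, hne, hz, hw, hnd z hz, hnd w hw, hzw⟩)

end EntireSpace

/-! ### The Baire category argument -/

open EntireSpace

theorem mainTheorem1 (ρ : ℕ+) (p : ℝ) (hp : 0 < p) :
    ∃ G : Set (EntireSpace ρ p), G ⊆ typicalSet ρ p ∧ IsGδ G ∧ Dense G := by
  let S : ℕ → Set (EntireSpace ρ p) := fun N => interior {f | closedBall 0 N ⊆ Set.range f}
  let T : ℕ → Set (EntireSpace ρ p) := fun N => interior {f | ∃ z ∈ criticalPoints f, (N : ℝ) < ‖z‖}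
  let A : ℕ → Set (EntireSpace ρ p) := fun N => nondegenerateOn ρ p N
  -- As `N` grows the disks exhaust the plane and the required distance tends to `0`, so every pair
  -- of distinct points is eventually covered.
  let B : ℕ → Set (EntireSpace ρ p) := fun N => separatedOn ρ p N (1 / (N + 1))
  have hAB : ∀ N, IsOpen (A N ∩ B N) := fun N =>
    (isOpen_nondegenerateOn _).inter (isOpen_separatedOn _ _)
  have hopen : ∀ N, IsOpen (S N ∩ (T N ∩ (A N ∩ B N))) := fun N =>
    isOpen_interior.inter (isOpen_interior.inter (hAB N))
  refine ⟨⋂ N, S N ∩ (T N ∩ (A N ∩ B N)), fun f hf => ?_,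
    .iInter_of_isOpen hopen, dense_iInter_of_isOpen hopen fun N => ?_⟩
  · rw [Set.mem_iInter] at hf
    have hcrit : ∀ N : ℕ, ∃ z ∈ criticalPoints f, (N : ℝ) < ‖z‖ := fun N =>
      (interior_subset (hf N).2.1 : f ∈ {f : EntireSpace ρ p | _})
    refine ⟨f.differentiable, fun c => ?_, fun hfin => ?_, fun z hz => ?_, fun z hz w hw hzw => ?_⟩
    · obtain ⟨N, hN⟩ := exists_nat_ge ‖c‖
      exact interior_subset (hf N).1 (mem_closedBall_zero_iff.2 hN)
    · obtain ⟨R, hR⟩ := hfin.isBounded.exists_norm_le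
      obtain ⟨N, hN⟩ := exists_nat_ge R
      obtain ⟨z, hz, hzN⟩ := hcrit N
      exact absurd (hR z hz) (not_le.2 (hN.trans_lt hzN))
    · obtain ⟨N, hN⟩ := exists_nat_ge ‖z‖
      exact ((hf N).2.2.1 z (mem_closedBall_zero_iff.2 hN)).resolve_left (not_not.2 hz)
    · by_contra hne
      obtain ⟨k, hk⟩ := exists_nat_one_div_lt (dist_pos.2 hne)
      obtain ⟨N, hN⟩ := exists_nat_ge (max (max ‖z‖ ‖w‖) k)
      simp only [max_le_iff] at hN
      have hδ : 1 / ((N : ℝ) + 1) ≤ dist z w :=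
        (one_div_le_one_div_of_le (by positivity) (by linarith [hN.2])).trans hk.le
      rcases (hf N).2.2.2 (z, w) ⟨⟨mem_closedBall_zero_iff.2 hN.1.1,
        mem_closedBall_zero_iff.2 hN.1.2⟩, hδ⟩ with h | h | h
      · exact h hz
      · exact h hw
      · exact h hzw
  · refine (dense_interior_closedBall_subset_range ρ hp N).inter_of_isOpen_left
      ((dense_interior_exists_criticalPoint ρ hp N).inter_of_isOpen_left
        ((dense_nondegenerate_injOn ρ hp).mono ?_) isOpen_interior) isOpen_interior
    rintro f ⟨hf, hinj⟩
    refine ⟨fun z _ => or_iff_not_imp_left.2 fun h => hf z (not_not.1 h), fun x hx => ?_⟩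
    by_contra! h
    have hxx : x.1 = x.2 := hinj h.1 h.2.1 h.2.2
    have hd : 1 / ((N : ℝ) + 1) ≤ dist x.1 x.2 := hx.2
    rw [hxx, dist_self] at hd
    exact absurd hd (not_le.2 (by positivity))
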